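/- For integers $a,b,m\ge 1$, an $(a,b,m)$-copartition is a triple of partitions $(\gamma,\rho,\sigma)$ such that each part of $\gamma$ is at least $a$ and congruent to $a \pmod m$, each part of $\sigma$ is at least $b$ and congruent to $b \pmod m$, and $\rho$ has the same number of parts as $\sigma$, each of size equal to $m$ times the number of parts of $\gamma$ (so $\rho$ is regarded as empty when $\gamma$ is empty). Its size is the sum of all parts of $\gamma$, $\rho$ and $\sigma$, and $\mathrm{cp}_{a,b,m}(n)$ denotes the number of $(a,b,m)$-copartitions of size $n$. Theorem. We have $$\lim_{n\to\infty}\frac{\#\{1\le k\le n \mid \mathrm{cp}_{5,1,6}(k)\text{ is even}\}}{n}=1.$$ Moreover, for every integer $n\ge 0$, $\mathrm{cp}_{5,1,6}(n)$ is even whenever some prime $p\equiv 2\pmod 3$ occurs with an odd exponent in the prime factorization of $6n+1$. -/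

import Mathlib

open Filter Topology

/-- An `(a,b,m)`-copartition: a triple of partitions `(γ, ρ, σ)` = (`ground`, `rect`, `sky`), each
given as a finite multiset of positive integers. The parts of `γ` are at least `a` and congruent
to `a` modulo `m`, those of `σ` are at least `b` and congruent to `b` modulo `m`, and `ρ` has as
many parts as `σ`, each equal to `m` times the number of parts of `γ`. If `γ` is empty these parts
are `0` and, as usual for partitions, zero parts are discarded: `ρ` is then empty. -/
@[ext]
structure Copartition (a b m : ℕ) where
  ground : Multiset ℕ
  rect : Multiset ℕ
  sky : Multiset ℕ
  ground_pos : ∀ x ∈ ground, 0 < x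
  ground_le : ∀ x ∈ ground, a ≤ x
  ground_modEq : ∀ x ∈ ground, x ≡ a [MOD m]
  sky_pos : ∀ x ∈ sky, 0 < x
  sky_le : ∀ x ∈ sky, b ≤ x
  sky_modEq : ∀ x ∈ sky, x ≡ b [MOD m]
  rect_eq : rect = (Multiset.replicate sky.card (m * ground.card)).filter (fun x => x ≠ 0)

namespace Copartition

/-- The size of a copartition: the sum of all the parts of its three partitions. -/
def size {a b m : ℕ} (c : Copartition a b m) : ℕ :=
  c.ground.sum + c.rect.sum + c.sky.sum

/-- There are only finitely many copartitions of a given size, so that counting them with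
`Set.ncard` is meaningful. -/
theorem finite_size_eq (a b m n : ℕ) : {c : Copartition a b m | c.size = n}.Finite := by
  have hS : (⋃ k ∈ Set.Iic n, Set.range (fun p : Nat.Partition k => p.parts)).Finite :=
    (Set.finite_Iic n).biUnion fun k _ => Set.finite_range _
  have hmem : ∀ s : Multiset ℕ, (∀ x ∈ s, 0 < x) → s.sum ≤ n →
      s ∈ ⋃ k ∈ Set.Iic n, Set.range (fun p : Nat.Partition k => p.parts) := by
    intro s hs hn
    simp only [Set.mem_iUnion]
    exact ⟨s.sum, hn, ⟨s, fun {i} hi => hs i hi, rfl⟩, rfl⟩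
  refine Set.Finite.of_finite_image (f := fun c => (c.ground, c.sky))
    ((hS.prod hS).subset ?_) ?_
  · rintro _ ⟨c, hc, rfl⟩
    have hc' : c.ground.sum + c.rect.sum + c.sky.sum = n := hc
    have h1 : c.ground.sum ≤ n := by omega
    have h2 : c.sky.sum ≤ n := by omega
    exact ⟨hmem _ c.ground_pos h1, hmem _ c.sky_pos h2⟩
  · intro c _ d _ h
    simp only [Prod.mk.injEq] at h
    ext1
    · exact h.1
    · rw [c.rect_eq, d.rect_eq, h.1, h.2]
    · exact h.2

end Copartition

/-- `cp a b m n` is the number of `(a,b,m)`-copartitions of size `n`. -/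
noncomputable def cp (a b m n : ℕ) : ℕ :=
  {c : Copartition a b m | c.size = n}.ncard

/-! Splitting copartitions according to whether a smallest possible part occurs gives recursions in
`a` and `b` for their generating function, and these lead to the product ∏(1 - q^(a+b+mj)) / ∏(1 -
q^(a+mj))(1 - q^(b+mj)). For (5,1,6), sorting exponents by residue modulo 6 turns this into
E(q²)E(q³)/E(q), where E(q) = ∏(1 - q^k). Modulo 2 one has E(q²) = E(q)², so what remains is
E(q)E(q³) (`pairSeries_six_five_one`).

By the pentagonal number theorem, an odd value at n forces n to be a pentagonal number plus three
times another; completing squares, 4(6n+1) = x² + 3y². Since -3 is not a square modulo an odd prime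
p ≡ 2 mod 3, such p divide 6n+1 to an even power, which is the second claim.

For the density, an odd value at n means that no prime p ≡ 5 mod 6 divides 6n+1 exactly once. Each
such p leaves a proportion of at most exp(-1/(2p)) of the residues modulo p², and by the Chinese
remainder theorem the proportions multiply. As ∑ 1/p over these primes diverges
(`not_summable_one_div_prime_residueClass`), finitely many primes make the density of odd values as
small as desired. -/

/-! ### Copartitions as pairs of multisets, and their recursion -/

/-- The size of the `(a,b,m)`-copartition whose ground parts are `a + m * g`, `g ∈ P.1`, and whose
sky parts are `b + m * s`, `s ∈ P.2`. -/
def pairWeight (m a b : ℕ) (P : Multiset ℕ × Multiset ℕ) : ℕ :=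
  a * P.1.card + m * P.1.sum + (b * P.2.card + m * P.2.sum) + m * (P.1.card * P.2.card)

/-- The number of pairs of multisets of a given `pairWeight`. -/
noncomputable def pairCount (m a b n : ℕ) : ℕ :=
  {P : Multiset ℕ × Multiset ℕ | pairWeight m a b P = n}.ncard

/-- Entries may be 0, so a bound on the sum alone would leave infinitely many multisets. -/
theorem Multiset.finite_card_le_sum_le (n : ℕ) :
    {G : Multiset ℕ | G.card ≤ n ∧ G.sum ≤ n}.Finite := by
  refine (Set.finite_Iic (n • Multiset.range (n + 1))).subset fun G hG => ?_
  rw [Set.mem_Iic, Multiset.le_iff_count]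
  intro x
  by_cases hx : x ∈ G
  · have h1 : x ≤ n := (Multiset.single_le_sum (fun _ _ => Nat.zero_le _) x hx).trans hG.2
    have h2 : Multiset.count x (Multiset.range (n + 1)) = 1 :=
      Multiset.count_eq_one_of_mem (Multiset.nodup_range _) (Multiset.mem_range.2 (by omega))
    rw [Multiset.count_nsmul, h2, mul_one]
    exact (Multiset.count_le_card x G).trans hG.1
  · simp [Multiset.count_eq_zero_of_notMem hx]

theorem finite_pairWeight_eq {m a b : ℕ} (hm : 0 < m) (ha : 0 < a) (hb : 0 < b) (n : ℕ) :
    {P : Multiset ℕ × Multiset ℕ | pairWeight m a b P = n}.Finite := by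
  refine ((Multiset.finite_card_le_sum_le n).prod (Multiset.finite_card_le_sum_le n)).subset ?_
  rintro ⟨G, S⟩ h
  have h' : a * G.card + m * G.sum + (b * S.card + m * S.sum) + m * (G.card * S.card) = n := h
  have h1 := Nat.le_mul_of_pos_left G.card ha
  have h2 := Nat.le_mul_of_pos_left G.sum hm
  have h3 := Nat.le_mul_of_pos_left S.card hb
  have h4 := Nat.le_mul_of_pos_left S.sum hm
  exact ⟨⟨by dsimp only; omega, by dsimp only; omega⟩, ⟨by dsimp only; omega, by dsimp only; omega⟩⟩

theorem pairCount_comm (m a b n : ℕ) : pairCount m a b n = pairCount m b a n := by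
  refine Set.ncard_congr (fun P _ => P.swap) ?_ (fun _ _ _ _ h => Prod.swap_injective h) ?_
  · rintro ⟨G, S⟩ h
    simp only [Set.mem_ofPred_eq, pairWeight, Prod.fst_swap, Prod.snd_swap] at h ⊢
    linarith [mul_comm G.card S.card]
  · rintro ⟨G, S⟩ h
    refine ⟨(S, G), ?_, rfl⟩
    simp only [Set.mem_ofPred_eq, pairWeight] at h ⊢
    linarith [mul_comm G.card S.card]

theorem Multiset.sum_map_add_mul (a m : ℕ) (G : Multiset ℕ) :
    (G.map fun x => a + m * x).sum = a * G.card + m * G.sum := by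
  rw [Multiset.sum_map_add, Multiset.map_const', Multiset.sum_replicate, Multiset.sum_map_mul_left,
    smul_eq_mul, mul_comm, Multiset.map_id']

theorem Multiset.exists_map_add_mul_eq {a m : ℕ} {G : Multiset ℕ} (h : ∀ x ∈ G, a ≤ x)
    (h' : ∀ x ∈ G, x ≡ a [MOD m]) : ∃ G' : Multiset ℕ, G'.map (fun x => a + m * x) = G := by
  refine ⟨G.map fun x => (x - a) / m, ?_⟩
  rw [Multiset.map_map]
  conv_rhs => rw [← Multiset.map_id G]
  refine Multiset.map_congr rfl fun x hx => ?_
  have := Nat.mul_div_cancel' ((Nat.modEq_iff_dvd' (h x hx)).1 (h' x hx).symm)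
  have := h x hx
  simp only [Function.comp_apply, id]
  omega

theorem injective_add_mul {m : ℕ} (a : ℕ) (hm : 0 < m) :
    Function.Injective fun x : ℕ => a + m * x := fun x y h => by
  simpa [hm.ne'] using h

/-- If 0 is not in the first multiset, lowering every entry by 1 trades `a` for `a + m`. If it is,
deleting one 0 frees weight `a`, and the lost cross term, `m` per entry of the second multiset,
trades `b` for `b + m`. -/
theorem pairCount_add {m a b : ℕ} (hm : 0 < m) (ha : 0 < a) (hb : 0 < b) (n : ℕ) :
    pairCount m a b n =
      pairCount m (a + m) b n + if a ≤ n then pairCount m a (b + m) (n - a) else 0 := by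
  set f : Multiset ℕ × Multiset ℕ → Multiset ℕ × Multiset ℕ :=
    fun P => (P.1.map fun x => 1 + 1 * x, P.2) with hf
  set g : Multiset ℕ × Multiset ℕ → Multiset ℕ × Multiset ℕ := fun P => (0 ::ₘ P.1, P.2) with hg
  have hfi : Function.Injective f := fun P Q h =>
    Prod.ext (Multiset.map_injective (injective_add_mul 1 one_pos) (congrArg Prod.fst h))
      (congrArg Prod.snd h :)
  have hgi : Function.Injective g := fun P Q h =>
    Prod.ext ((Multiset.cons_inj_right 0).1 (congrArg Prod.fst h)) (congrArg Prod.snd h :)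
  have hfw : ∀ P, pairWeight m a b (f P) = pairWeight m (a + m) b P := fun P => by
    simp only [pairWeight, hf, Multiset.sum_map_add_mul, Multiset.card_map]
    ring
  have hgw : ∀ P, pairWeight m a b (g P) = a + pairWeight m a (b + m) P := fun P => by
    simp only [pairWeight, hg, Multiset.sum_cons, Multiset.card_cons]
    ring
  have hsplit : {P | pairWeight m a b P = n} =
      f '' {P | pairWeight m (a + m) b P = n} ∪ g '' {P | a + pairWeight m a (b + m) P = n} := by
    ext ⟨G, S⟩
    constructor
    · intro h
      by_cases h0 : 0 ∈ G
      · obtain ⟨G', rfl⟩ := Multiset.exists_cons_of_mem h0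
        exact Or.inr ⟨(G', S), (hgw (G', S)).symm.trans h, rfl⟩
      · obtain ⟨G', rfl⟩ := Multiset.exists_map_add_mul_eq (a := 1) (m := 1) (G := G)
          (fun x hx => Nat.one_le_iff_ne_zero.2 fun h => h0 (h ▸ hx)) fun x _ => Nat.modEq_one
        exact Or.inl ⟨(G', S), (hfw (G', S)).symm.trans h, rfl⟩
    · rintro (⟨P, h, hP⟩ | ⟨P, h, hP⟩)
      · rw [← hP]
        exact (hfw P).trans h
      · rw [← hP]
        exact (hgw P).trans h
  have hg' : (g '' {P | a + pairWeight m a (b + m) P = n}).ncard =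
      if a ≤ n then pairCount m a (b + m) (n - a) else 0 := by
    rw [Set.ncard_image_of_injective _ hgi]
    split_ifs with h
    · congr 1
      ext P
      simp only [Set.mem_ofPred_eq]
      omega
    · rw [Set.ncard_eq_zero (Set.Finite.subset (Set.finite_empty) fun P hP => ?_)]
      · ext P
        simp only [Set.mem_ofPred_eq, Set.mem_empty_iff_false, iff_false]
        omega
      · simp only [Set.mem_ofPred_eq] at hP
        omega
  have hfin := finite_pairWeight_eq hm ha hb n
  have hfin' := hfin
  rw [hsplit, Set.finite_union] at hfin'
  rw [pairCount, hsplit, Set.ncard_union_eq ?_ hfin'.1 hfin'.2, hg',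
    Set.ncard_image_of_injective _ hfi]
  · rfl
  · rw [Set.disjoint_left]
    rintro _ ⟨P, -, rfl⟩ ⟨Q, -, h⟩
    have h0 : 0 ∈ (f P).1 := h ▸ Multiset.mem_cons_self 0 Q.1
    simp [hf] at h0

theorem pairCount_zero {m a b : ℕ} (hm : 0 < m) (ha : 0 < a) (hb : 0 < b) :
    pairCount m a b 0 = 1 := by
  rw [pairCount, Set.ncard_eq_one]
  refine ⟨(0, 0), ?_⟩
  ext ⟨G, S⟩
  simp only [Set.mem_ofPred_eq, Set.mem_singleton_iff, Prod.mk.injEq, pairWeight]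
  constructor
  · intro h
    simp only [Nat.add_eq_zero_iff, mul_eq_zero, ha.ne', hb.ne', hm.ne', Multiset.card_eq_zero,
      false_or] at h
    exact ⟨h.1.1.1, h.1.2.1⟩
  · rintro ⟨rfl, rfl⟩
    simp

theorem pairCount_eq_zero {m a b n : ℕ} (hn : 0 < n) (ha : n < a) (hb : n < b) :
    pairCount m a b n = 0 := by
  rw [pairCount, Set.eq_empty_of_forall_notMem (s := {P | pairWeight m a b P = n}),
    Set.ncard_empty]
  rintro ⟨G, S⟩ h
  simp only [Set.mem_ofPred_eq, pairWeight] at h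
  by_cases hG : G = 0
  · by_cases hS : S = 0
    · simp [hG, hS] at h
      omega
    · have := Nat.le_mul_of_pos_right b (Multiset.card_pos.2 hS)
      omega
  · have := Nat.le_mul_of_pos_right a (Multiset.card_pos.2 hG)
    omega

theorem Copartition.rect_sum {a b m : ℕ} (c : Copartition a b m) :
    c.rect.sum = m * (c.ground.card * c.sky.card) := by
  rw [c.rect_eq]
  by_cases h : m * c.ground.card = 0
  · rw [Multiset.filter_eq_nil.2 fun x hx => by simp [Multiset.eq_of_mem_replicate hx, h],
      Multiset.sum_zero, ← mul_assoc, h, zero_mul]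
  · rw [Multiset.filter_eq_self.2 fun x hx => by rwa [Multiset.eq_of_mem_replicate hx],
      Multiset.sum_replicate, smul_eq_mul]
    ring

theorem cp_eq_pairCount {m a b : ℕ} (hm : 0 < m) (ha : 0 < a) (hb : 0 < b) (n : ℕ) :
    cp a b m n = pairCount m a b n := by
  symm
  set f : Multiset ℕ × Multiset ℕ → Copartition a b m := fun P =>
    { ground := P.1.map fun x => a + m * x
      rect := (Multiset.replicate (P.2.map fun x => b + m * x).card
        (m * (P.1.map fun x => a + m * x).card)).filter (fun x => x ≠ 0)
      sky := P.2.map fun x => b + m * x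
      ground_pos := by simp +contextual [ha]
      ground_le := by simp +contextual
      ground_modEq := by simp +contextual [Nat.ModEq]
      sky_pos := by simp +contextual [hb]
      sky_le := by simp +contextual
      sky_modEq := by simp +contextual [Nat.ModEq]
      rect_eq := rfl } with hf
  have hfi : Function.Injective f := fun P Q h =>
    Prod.ext (Multiset.map_injective (injective_add_mul a hm) (congrArg Copartition.ground h))
      (Multiset.map_injective (injective_add_mul b hm) (congrArg Copartition.sky h))
  have hfs : ∀ P, (f P).size = pairWeight m a b P := fun P => by
    rw [Copartition.size, Copartition.rect_sum]
    simp only [hf, pairWeight, Multiset.sum_map_add_mul, Multiset.card_map]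
    ring
  rw [cp, pairCount, ← Set.ncard_image_of_injective _ hfi]
  congr 1
  ext c
  constructor
  · rintro ⟨P, h, rfl⟩
    exact (hfs P).trans h
  · intro h
    obtain ⟨G, hG⟩ := Multiset.exists_map_add_mul_eq c.ground_le c.ground_modEq
    obtain ⟨S, hS⟩ := Multiset.exists_map_add_mul_eq c.sky_le c.sky_modEq
    have hc : f (G, S) = c := by
      ext1
      · exact hG
      · rw [c.rect_eq, ← hG, ← hS]
      · exact hS
    exact ⟨(G, S), (hfs _).symm.trans (hc ▸ h), hc⟩

/-! ### The form x² + 3y² -/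

/-- `-3` is not a square modulo an odd prime `p ≡ 2 [MOD 3]`. -/
theorem Nat.Prime.dvd_of_dvd_sq_add_three_mul_sq {p : ℕ} (hp : p.Prime) (h2 : p ≠ 2)
    (h3 : p ≡ 2 [MOD 3]) {x y : ℤ} (h : (p : ℤ) ∣ x ^ 2 + 3 * y ^ 2) :
    (p : ℤ) ∣ x ∧ (p : ℤ) ∣ y := by
  have : Fact p.Prime := ⟨hp⟩
  have hp3 : p % 3 = 2 := h3
  have hy : (y : ZMod p) = 0 := by
    by_contra hy
    have h0 : (x : ZMod p) ^ 2 + 3 * (y : ZMod p) ^ 2 = 0 := by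
      have := (ZMod.intCast_zmod_eq_zero_iff_dvd (x ^ 2 + 3 * y ^ 2) p).2 h
      push_cast at this
      exact this
    have two : (2 : ZMod p) ≠ 0 := by
      intro h
      have : ((2 : ℕ) : ZMod p) = 0 := by exact_mod_cast h
      rw [ZMod.natCast_eq_zero_iff] at this
      exact h2 ((Nat.prime_dvd_prime_iff_eq hp Nat.prime_two).1 this)
    have three : (3 : ZMod p) ≠ 0 := by
      intro h
      have : ((3 : ℕ) : ZMod p) = 0 := by exact_mod_cast h
      rw [ZMod.natCast_eq_zero_iff] at this
      have := (Nat.prime_dvd_prime_iff_eq hp Nat.prime_three).1 this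
      omega
    -- If (x/y)² = -3 then this is a primitive cube root of unity, whose order 3 would have to
    -- divide p - 1.
    set w : ZMod p := (x / y - 1) / 2 with hw
    have hw1 : w ^ 2 + w + 1 = 0 := by
      rw [hw]
      field_simp
      linear_combination h0
    have hw3 : w ^ 3 = 1 := by linear_combination (w - 1) * hw1
    have hw1' : w ≠ 1 := by
      intro h
      rw [h] at hw1
      apply three
      linear_combination hw1
    have hord : orderOf w = 3 := orderOf_eq_prime hw3 hw1'
    have hw0 : w ≠ 0 := by
      intro h
      simp [h] at hw3
    have := orderOf_dvd_of_pow_eq_one (ZMod.pow_card_sub_one_eq_one hw0)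
    rw [hord] at this
    omega
  have hyd := (ZMod.intCast_zmod_eq_zero_iff_dvd y p).1 hy
  refine ⟨?_, hyd⟩
  have : (p : ℤ) ∣ x ^ 2 :=
    (Int.dvd_add_left (Dvd.dvd.mul_left (Dvd.dvd.pow hyd two_ne_zero) 3)).1 h
  exact (Nat.prime_iff_prime_int.1 hp).dvd_of_dvd_pow this

/-- Odd primes `p ≡ 2 [MOD 3]` occur with even exponent in numbers of the form `x² + 3y²`. -/
theorem even_factorization_of_eq_sq_add_three_mul_sq {p : ℕ} (hp : p.Prime) (h2 : p ≠ 2)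
    (h3 : p ≡ 2 [MOD 3]) (n : ℕ) (x y : ℤ) (h : (n : ℤ) = x ^ 2 + 3 * y ^ 2) :
    Even (n.factorization p) := by
  induction n using Nat.strong_induction_on generalizing x y with
  | _ n ih =>
    rcases Nat.eq_zero_or_pos n with rfl | hn
    · simp
    by_cases hd : p ∣ n
    -- Descent: `p` divides both `x` and `y`, so `p ^ 2` can be removed from `n`.
    · obtain ⟨⟨x', rfl⟩, y', rfl⟩ :=
        hp.dvd_of_dvd_sq_add_three_mul_sq h2 h3 (h ▸ Int.natCast_dvd_natCast.2 hd)
      have h' : (n : ℤ) = ((p ^ 2 : ℕ) : ℤ) * (x' ^ 2 + 3 * y' ^ 2) := by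
        rw [h]
        push_cast
        ring
      obtain ⟨k, rfl⟩ : p ^ 2 ∣ n := Int.natCast_dvd_natCast.1 ⟨_, h'⟩
      have hpp : 0 < p ^ 2 := pow_pos hp.pos 2
      have hk : 0 < k := Nat.pos_of_mul_pos_left hn
      have hk' : (k : ℤ) = x' ^ 2 + 3 * y' ^ 2 := by
        rw [Nat.cast_mul] at h'
        exact mul_left_cancel₀ (by exact_mod_cast hpp.ne') h'
      have := ih k (lt_mul_of_one_lt_left hk (Nat.one_lt_pow two_ne_zero hp.one_lt)) x' y' hk'
      rw [Nat.factorization_mul hpp.ne' hk.ne', Finsupp.add_apply, hp.factorization_pow,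
        Finsupp.single_eq_same]
      exact even_two.add this
    · simp [Nat.factorization_eq_zero_of_not_dvd hd]

/-! ### The product formula for the generating function -/

open PowerSeries

/-- The generating function of `pairCount m a b`. -/
noncomputable def pairSeries (R : Type*) [CommRing R] (m a b : ℕ) : R⟦X⟧ :=
  PowerSeries.mk fun n => (pairCount m a b n : R)

section PairSeries

variable {R : Type*} [CommRing R] {m a b : ℕ}

theorem pairSeries_comm : pairSeries R m a b = pairSeries R m b a := by
  simp only [pairSeries, pairCount_comm m a b]

theorem pairSeries_add (hm : 0 < m) (ha : 0 < a) (hb : 0 < b) :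
    pairSeries R m a b = pairSeries R m (a + m) b + X ^ a * pairSeries R m a (b + m) := by
  ext n
  rw [map_add, coeff_X_pow_mul', pairSeries, coeff_mk, pairCount_add hm ha hb, pairSeries,
    pairSeries, coeff_mk, Nat.cast_add]
  split_ifs <;> simp

/-- The recursion in `a` and its mirror image in `b` both involve the series at `(a + m, b)`;
eliminating it leaves this relation. -/
theorem one_sub_X_pow_mul_pairSeries (hm : 0 < m) (ha : 0 < a) (hb : 0 < b) :
    (1 - X ^ b) * pairSeries R m a b = (1 - X ^ (a + b)) * pairSeries R m a (b + m) := by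
  have h1 := pairSeries_add (R := R) hm ha hb
  have h2 := pairSeries_add (R := R) hm hb ha
  rw [pairSeries_comm, pairSeries_comm (a := b + m), pairSeries_comm (a := b)] at h2
  rw [pow_add]
  linear_combination h2 - X ^ b * h1

theorem prod_mul_pairSeries (hm : 0 < m) (ha : 0 < a) (hb : 0 < b) (N : ℕ) :
    (∏ j ∈ Finset.range N, (1 - X ^ (b + m * j))) * pairSeries R m a b =
      (∏ j ∈ Finset.range N, (1 - X ^ (a + b + m * j))) * pairSeries R m a (b + m * N) := by
  induction N with
  | zero => simp
  | succ N ih =>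
    have h := one_sub_X_pow_mul_pairSeries (R := R) hm ha (Nat.add_pos_left hb (m * N))
    rw [Finset.prod_range_succ, Finset.prod_range_succ, mul_add m, mul_one, ← add_assoc b, add_assoc a]
    linear_combination (1 - X ^ (b + m * N)) * ih +
      (∏ j ∈ Finset.range N, (1 - X ^ (a + b + m * j))) * h

/-- Eliminating the series at `(a, b + m)` instead gives a factor `1 - X ^ (a + b)` on the right,
which is 1 modulo `X ^ b`. This is used after `b` has been made large. -/
theorem X_pow_dvd_prod_mul_pairSeries_sub (hm : 0 < m) (ha : 0 < a) (hb : 0 < b) (n : ℕ) :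
    (X : R⟦X⟧) ^ b ∣ (∏ i ∈ Finset.range n, (1 - X ^ (a + m * i))) * pairSeries R m a b -
      pairSeries R m (a + m * n) b := by
  induction n with
  | zero => simp
  | succ n ih =>
    have h1 := pairSeries_add (R := R) hm (Nat.add_pos_left ha (m * n)) hb
    have h2 := pairSeries_add (R := R) hm hb (Nat.add_pos_left ha (m * n))
    rw [pairSeries_comm, pairSeries_comm (a := b + m), pairSeries_comm (a := b)] at h2
    obtain ⟨c, hc⟩ := ih
    refine ⟨(1 - X ^ (a + m * n)) * c -
      X ^ (a + m * n) * pairSeries R m (a + m * n + m) b, ?_⟩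
    rw [Finset.prod_range_succ, mul_add m, mul_one, ← add_assoc a]
    linear_combination (1 - X ^ (a + m * n)) * hc + h1 - X ^ (a + m * n) * h2

theorem X_pow_dvd_pairSeries_sub_one (hm : 0 < m) (ha : 0 < a) (hb : 0 < b) {N : ℕ} (hNa : N ≤ a)
    (hNb : N ≤ b) : (X : R⟦X⟧) ^ N ∣ pairSeries R m a b - 1 := by
  rw [X_pow_dvd_iff]
  intro n hn
  rw [map_sub, pairSeries, coeff_mk, coeff_one]
  split_ifs with h
  · rw [h, pairCount_zero hm ha hb]
    simp
  · rw [pairCount_eq_zero (Nat.pos_of_ne_zero h) (by omega) (by omega)]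
    simp

/-- The product formula for the generating function of copartitions, modulo `X ^ N`. -/
theorem X_pow_dvd_prod_mul_prod_mul_pairSeries_sub (hm : 0 < m) (ha : 0 < a) (hb : 0 < b) (N : ℕ) :
    (X : R⟦X⟧) ^ N ∣ (∏ i ∈ Finset.range N, (1 - X ^ (a + m * i))) *
      (∏ j ∈ Finset.range N, (1 - X ^ (b + m * j))) * pairSeries R m a b -
        ∏ j ∈ Finset.range N, (1 - X ^ (a + b + m * j)) := by
  have hN : N ≤ m * N := Nat.le_mul_of_pos_left N hm
  have h1 := prod_mul_pairSeries (R := R) hm ha hb N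
  have h2 := (pow_dvd_pow (X : R⟦X⟧) (show N ≤ b + m * N by omega)).trans
    (X_pow_dvd_prod_mul_pairSeries_sub (R := R) hm ha (Nat.add_pos_left hb (m * N)) N)
  have h3 := X_pow_dvd_pairSeries_sub_one (R := R) hm (Nat.add_pos_left ha (m * N))
    (Nat.add_pos_left hb (m * N)) (show N ≤ a + m * N by omega) (show N ≤ b + m * N by omega)
  convert (h2.add h3).mul_left (∏ j ∈ Finset.range N, (1 - X ^ (a + b + m * j))) using 1
  linear_combination (∏ i ∈ Finset.range N, (1 - X ^ (a + m * i))) * h1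

end PairSeries

/-! ### Euler products and the reduction modulo 2 -/

/-- The finite product `∏ (1 - X ^ (k (i + 1)))` over `i < n`. -/
noncomputable def eulerProd (R : Type*) [CommRing R] (k n : ℕ) : R⟦X⟧ :=
  ∏ i ∈ Finset.range n, (1 - X ^ (k * (i + 1)))

section EulerProd

variable {R : Type*} [CommRing R]

theorem eulerProd_eq_expand {k : ℕ} (hk : k ≠ 0) (n : ℕ) :
    eulerProd R k n = expand k hk (eulerProd R 1 n) := by
  simp [eulerProd, map_prod, pow_mul]

theorem X_pow_dvd_eulerProd_one_sub {N n : ℕ} (h : N ≤ n) :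
    (X : R⟦X⟧) ^ N ∣ eulerProd R 1 n - pentagonalSeries R := by
  rw [X_pow_dvd_iff]
  intro d hd
  -- Factors beyond the first `d` do not affect the coefficient of `X ^ d`, so it already has its
  -- limiting value.
  have hconst : ∀ l, d ≤ l → coeff d (eulerProd R 1 l) = coeff d (eulerProd R 1 d) := by
    intro l hl
    induction l, hl using Nat.le_induction with
    | base => rfl
    | succ l hl ih =>
      rw [eulerProd, Finset.prod_range_succ, ← eulerProd, mul_sub, map_sub, mul_one,
        coeff_mul_X_pow', if_neg (by omega), sub_zero, ih]
  have hev := tendsto_finset_range.eventually (coeff_prod_one_sub_X_pow_eventually_eq R d)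
  obtain ⟨l, hl, hl'⟩ := (hev.and (eventually_ge_atTop d)).exists
  have hl2 : coeff d (eulerProd R 1 l) = coeff d (pentagonalSeries R) := by
    rw [← hl, eulerProd]
    simp only [one_mul]
  rw [map_sub, hconst n (by omega), ← hconst l hl', hl2, sub_self]

theorem X_pow_dvd_eulerProd_sub {k N n : ℕ} (hk : k ≠ 0) (h : N ≤ n) :
    (X : R⟦X⟧) ^ N ∣ eulerProd R k n - expand k hk (pentagonalSeries R) := by
  rw [eulerProd_eq_expand hk, ← map_sub]
  have := map_dvd (expand k hk) (X_pow_dvd_eulerProd_one_sub (R := R) h)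
  rw [map_pow, expand_X, ← pow_mul] at this
  exact (pow_dvd_pow X (Nat.le_mul_of_pos_left N (Nat.pos_of_ne_zero hk))).trans this

/-- Inclusion–exclusion on the exponents up to 6N: the multiples of 2 together with those of 3 cover
all but the residues 1 and 5, counting multiples of 6 twice. The truncations match, so the identity
is exact. -/
theorem eulerProd_mod_six (N : ℕ) :
    (∏ i ∈ Finset.range N, (1 - X ^ (5 + 6 * i))) * (∏ j ∈ Finset.range N, (1 - X ^ (1 + 6 * j))) *
      (eulerProd R 2 (3 * N) * eulerProd R 3 (2 * N)) =
        eulerProd R 1 (6 * N) * eulerProd R 6 N := by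
  induction N with
  | zero => simp [eulerProd]
  | succ N ih =>
    simp only [eulerProd] at ih ⊢
    simp only [mul_add, mul_one, Finset.prod_range_succ, one_mul] at ih ⊢
    generalize (∏ i ∈ Finset.range N, ((1 : R⟦X⟧) - X ^ (5 + 6 * i))) = A at *
    generalize (∏ i ∈ Finset.range N, ((1 : R⟦X⟧) - X ^ (1 + 6 * i))) = B at *
    generalize (∏ i ∈ Finset.range (3 * N), ((1 : R⟦X⟧) - X ^ (2 * i + 2))) = C at *
    generalize (∏ i ∈ Finset.range (2 * N), ((1 : R⟦X⟧) - X ^ (3 * i + 3))) = D at *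
    generalize (∏ i ∈ Finset.range (6 * N), ((1 : R⟦X⟧) - X ^ (i + 1))) = E at *
    generalize (∏ i ∈ Finset.range N, ((1 : R⟦X⟧) - X ^ (6 * i + 6))) = G at *
    linear_combination (1 - X ^ (6 * N + 1)) * (1 - X ^ (6 * N + 2)) * (1 - X ^ (6 * N + 3)) *
      (1 - X ^ (6 * N + 4)) * (1 - X ^ (6 * N + 5)) * (1 - X ^ (6 * N + 6)) *
      (1 - X ^ (6 * N + 6)) * ih

theorem eulerProd_two_of_charP [CharP R 2] (n : ℕ) : eulerProd R 2 n = eulerProd R 1 n ^ 2 := by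
  have h2 : (2 : R⟦X⟧) = 0 := by
    rw [← map_ofNat (C (R := R)) 2, CharTwo.two_eq_zero, map_zero]
  rw [eulerProd, eulerProd, ← Finset.prod_pow]
  refine Finset.prod_congr rfl fun i _ => ?_
  rw [one_mul, mul_comm 2, pow_mul]
  linear_combination (X ^ (i + 1) - (X ^ (i + 1)) ^ 2) * h2

end EulerProd

theorem pairSeries_six_five_one :
    pairSeries (ZMod 2) 6 5 1 =
      pentagonalSeries (ZMod 2) * expand 3 three_ne_zero (pentagonalSeries (ZMod 2)) := by
  set p := pentagonalSeries (ZMod 2) with hp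
  set F := pairSeries (ZMod 2) 6 5 1 with hF
  have hp0 : p ≠ 0 := by
    intro h
    have := coeff_pentagonalSeries_pentagonal (ZMod 2) 0
    rw [← hp, h] at this
    simp at this
  have he0 : expand 6 (by norm_num) p ≠ 0 := by
    intro h
    apply hp0
    ext n
    rw [← coeff_expand_mul 6 (by norm_num), h]
    simp
  -- The product formula is compared modulo every power of `X`, with denominators cleared; the extra
  -- nonzero factor cancels at the end.
  have key : (p * expand 6 (by norm_num) p) * F =
      (p * expand 6 (by norm_num) p) * (p * expand 3 three_ne_zero p) := by
    rw [← sub_eq_zero]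
    ext N
    have hdvd : (X : (ZMod 2)⟦X⟧) ^ (N + 1) ∣ (p * expand 6 (by norm_num) p) * F -
        (p * expand 6 (by norm_num) p) * (p * expand 3 three_ne_zero p) := by
      have h0 := X_pow_dvd_prod_mul_prod_mul_pairSeries_sub (R := ZMod 2) (m := 6) (a := 5) (b := 1)
        (by norm_num) (by norm_num) (by norm_num) (N + 1)
      have h1 := X_pow_dvd_eulerProd_one_sub (R := ZMod 2) (show N + 1 ≤ 6 * (N + 1) by omega)
      have h2 := X_pow_dvd_eulerProd_one_sub (R := ZMod 2) (show N + 1 ≤ 3 * (N + 1) by omega)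
      have h3 := X_pow_dvd_eulerProd_sub (R := ZMod 2) three_ne_zero
        (show N + 1 ≤ 2 * (N + 1) by omega)
      have h6 := X_pow_dvd_eulerProd_sub (R := ZMod 2) (show 6 ≠ 0 by norm_num) (le_refl (N + 1))
      have hmod := congrArg (Ideal.Quotient.mk (Ideal.span {(X : (ZMod 2)⟦X⟧) ^ (N + 1)}))
        (eulerProd_mod_six (R := ZMod 2) (N + 1))
      have h6' : ∏ j ∈ Finset.range (N + 1), ((1 : (ZMod 2)⟦X⟧) - X ^ (5 + 1 + 6 * j)) =
          eulerProd (ZMod 2) 6 (N + 1) :=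
        Finset.prod_congr rfl fun j _ => by rw [show 5 + 1 + 6 * j = 6 * (j + 1) by ring]
      rw [h6'] at h0
      rw [eulerProd_two_of_charP] at hmod
      rw [← Ideal.mem_span_singleton, ← Ideal.Quotient.eq] at h0 h1 h2 h3 h6 ⊢
      simp only [map_mul, map_pow, h1, h2, h3, h6] at hmod
      rw [map_mul, map_mul, h6] at h0
      simp only [map_mul]
      linear_combination
        (Ideal.Quotient.mk (Ideal.span {(X : (ZMod 2)⟦X⟧) ^ (N + 1)}) p ^ 2 *
        Ideal.Quotient.mk (Ideal.span {(X : (ZMod 2)⟦X⟧) ^ (N + 1)}) (expand 3 three_ne_zero p)) *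
          h0 - Ideal.Quotient.mk (Ideal.span {(X : (ZMod 2)⟦X⟧) ^ (N + 1)}) F * hmod
    rw [X_pow_dvd_iff] at hdvd
    simpa using hdvd N (Nat.lt_succ_self N)
  exact mul_left_cancel₀ (mul_ne_zero hp0 he0) key

/-- If `cp 5 1 6 n` is odd then `4 (6 n + 1)` is of the form `x² + 3y²`. -/
theorem exists_eq_sq_add_three_mul_sq_of_odd_cp {n : ℕ} (h : ¬ Even (cp 5 1 6 n)) :
    ∃ x y : ℤ, ((4 * (6 * n + 1) : ℕ) : ℤ) = x ^ 2 + 3 * y ^ 2 := by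
  have h1 : coeff n (pairSeries (ZMod 2) 6 5 1) ≠ 0 := by
    rwa [pairSeries, coeff_mk, ← cp_eq_pairCount (by norm_num) (by norm_num) (by norm_num), Ne,
      ZMod.natCast_eq_zero_iff_even]
  rw [pairSeries_six_five_one, coeff_mul] at h1
  obtain ⟨⟨k, l⟩, hkl, hne⟩ := Finset.exists_ne_zero_of_sum_ne_zero h1
  have hk := left_ne_zero_of_mul hne
  have hl := right_ne_zero_of_mul hne
  rw [Finset.HasAntidiagonal.mem_antidiagonal] at hkl
  dsimp only at hkl hk hl
  rw [coeff_expand] at hl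
  split_ifs at hl with h3
  · obtain ⟨l, rfl⟩ := h3
    rw [Nat.mul_div_cancel_left l three_pos] at hl
    rw [Ne, coeff_pentagonalSeries_eq_zero_iff, not_not] at hk hl
    obtain ⟨i, rfl⟩ := hk
    obtain ⟨j, rfl⟩ := hl
    -- Completing the square: 24 · i(3i-1)/2 + 1 = (6i-1)².
    refine ⟨6 * i - 1, 6 * j - 1, ?_⟩
    rw [← hkl]
    push_cast
    linear_combination 12 * two_mul_natCast_pentagonal i + 36 * two_mul_natCast_pentagonal j
  · exact absurd rfl hl

theorem even_cp_of_odd_factorization {n p : ℕ} (hp : p.Prime) (h3 : p ≡ 2 [MOD 3])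
    (h : Odd ((6 * n + 1).factorization p)) : Even (cp 5 1 6 n) := by
  by_contra hodd
  obtain ⟨x, y, hxy⟩ := exists_eq_sq_add_three_mul_sq_of_odd_cp hodd
  have h2 : p ≠ 2 := by
    rintro rfl
    rw [Nat.factorization_eq_zero_of_not_dvd (by omega)] at h
    exact Nat.not_odd_zero h
  have hev := even_factorization_of_eq_sq_add_three_mul_sq hp h2 h3 _ x y hxy
  have h4 : (4 : ℕ).factorization p = 0 := by
    refine Nat.factorization_eq_zero_of_not_dvd fun hd => h2 ?_
    exact (Nat.prime_dvd_prime_iff_eq hp Nat.prime_two).1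
      (hp.dvd_of_dvd_pow (show p ∣ 2 ^ 2 from hd))
  rw [Nat.factorization_mul (by norm_num) (by omega), Finsupp.add_apply, h4, zero_add] at hev
  exact (Nat.not_even_iff_odd.2 h) hev

/-! ### Divergence of the sum of prime reciprocals in a residue class -/

open ArithmeticFunction ArithmeticFunction.vonMangoldt in
/-- The sum of the reciprocals of the primes in an invertible residue class diverges. -/
theorem not_summable_one_div_prime_residueClass {q : ℕ} [NeZero q] {a : ZMod q} (ha : IsUnit a) :
    ¬ Summable ({p : ℕ | p.Prime ∧ (p : ZMod q) = a}.indicator fun p => 1 / (p : ℝ)) := by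
  intro H
  obtain ⟨C, hC⟩ := LSeries_residueClass_lower_bound ha
  set u : ℕ → ℝ := {p : ℕ | p.Prime ∧ (p : ZMod q) = a}.indicator fun p => 1 / (p : ℝ) with hu
  set v : ℕ → ℝ := fun n => (if n.Prime then 0 else residueClass a n) / n with hv
  have hvs : Summable v := summable_residueClass_non_primes_div a
  -- For a prime p in the class this is ε · log p / p^(1+ε). Since t·exp(-t) ≤ 1 it is dominated by
  -- 1/p, and it tends to 0 with ε; if ∑ 1/p converged, the whole sum would tend to 0. The pole of
  -- the L-series at 1 keeps it above 1/φ(q) - O(ε).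
  set w : ℝ → ℕ → ℝ := fun ε n => u n * (ε * Real.log n * Real.exp (-(ε * Real.log n))) with hw
  have hu0 : ∀ n, 0 ≤ u n := fun n => Set.indicator_nonneg (fun _ _ => by positivity) n
  have hv0 : ∀ n, 0 ≤ v n := fun n => by
    rw [hv]
    positivity [residueClass_nonneg a n]
  have hbound : ∀ ε : ℝ, 0 < ε → ∀ n, ‖w ε n‖ ≤ u n := fun ε hε n => by
    have h1 : 0 ≤ ε * Real.log n := mul_nonneg hε.le (Real.log_natCast_nonneg n)
    have h2 : ε * Real.log n * Real.exp (-(ε * Real.log n)) ≤ 1 := by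
      rw [Real.exp_neg, ← div_eq_mul_inv, div_le_one (Real.exp_pos _)]
      linarith [Real.add_one_le_exp (ε * Real.log n)]
    rw [Real.norm_of_nonneg (mul_nonneg (hu0 n) (mul_nonneg h1 (Real.exp_pos _).le))]
    exact mul_le_of_le_one_right (hu0 n) h2
  have hlim : Tendsto (fun ε : ℝ => ∑' n, w ε n) (𝓝[>] 0) (𝓝 (∑' _ : ℕ, (0 : ℝ))) := by
    refine tendsto_tsum_of_dominated_convergence H (fun n => ?_)
      (eventually_mem_nhdsWithin.mono fun ε hε n => hbound ε hε n)
    have : Continuous fun ε : ℝ => w ε n := by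
      rw [hw]
      fun_prop
    have h := (this.tendsto 0).mono_left (nhdsWithin_le_nhds (s := Set.Ioi 0))
    simpa [hw] using h
  have hterm : ∀ ε : ℝ, 0 < ε → ∀ n : ℕ,
      ε * (residueClass a n / (n : ℝ) ^ (1 + ε)) ≤ w ε n + ε * v n := fun ε hε n => by
    rcases Nat.eq_zero_or_pos n with rfl | hn
    · simp [hu, hv, hw]
    have hn' : (0 : ℝ) < n := by exact_mod_cast hn
    have hp : (n : ℝ) ^ (1 + ε) = n * Real.exp (ε * Real.log n) := by
      rw [Real.rpow_add hn', Real.rpow_one, Real.rpow_def_of_pos hn', mul_comm (Real.log _)]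
    by_cases hnp : n.Prime
    · have hvn : v n = 0 := by simp [hv, hnp]
      rw [hvn, mul_zero, add_zero, hp]
      by_cases hna : (n : ZMod q) = a
      · have h1 : residueClass a n = Real.log n := by
          rw [residueClass, Set.indicator_of_mem (by exact hna), vonMangoldt_apply_prime hnp]
        have h2 : u n = 1 / n := Set.indicator_of_mem (by exact ⟨hnp, hna⟩) _
        rw [h1, hw]
        simp only [h2, Real.exp_neg]
        refine le_of_eq ?_
        field_simp
      · have h1 : residueClass a n = 0 := Set.indicator_of_notMem (by exact hna) _
        have h2 : u n = 0 := Set.indicator_of_notMem (by exact fun h => hna h.2) _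
        simp [h1, hw, h2]
    · have h2 : u n = 0 := Set.indicator_of_notMem (by exact fun h => hnp h.1) _
      simp only [hw, h2, zero_mul, zero_add, hv, hnp, if_false]
      refine mul_le_mul_of_nonneg_left ?_ hε.le
      refine div_le_div_of_nonneg_left (residueClass_nonneg a n) hn' ?_
      rw [hp]
      exact le_mul_of_one_le_right hn'.le
        (Real.one_le_exp (mul_nonneg hε.le (Real.log_natCast_nonneg n)))
  have hsum : ∀ ε ∈ Set.Ioc (0 : ℝ) 1,
      (q.totient : ℝ)⁻¹ ≤ ∑' n, w ε n + ε * (∑' n, v n) + ε * C := fun ε hε => by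
    have h1 := hC (x := 1 + ε) ⟨by linarith [hε.1], by linarith [hε.2]⟩
    rw [add_sub_cancel_left] at h1
    have hws : Summable (w ε) := Summable.of_norm_bounded H (hbound ε hε.1)
    have h2 : ε * ∑' n, residueClass a n / (n : ℝ) ^ (1 + ε) ≤ ∑' n, w ε n + ε * ∑' n, v n := by
      have hs := hws.add (hvs.mul_left ε)
      rw [← tsum_mul_left, ← tsum_mul_left, ← hws.tsum_add (hvs.mul_left ε)]
      refine Summable.tsum_le_tsum (hterm ε hε.1) (Summable.of_nonneg_of_le (fun n => ?_)
        (hterm ε hε.1) hs) hs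
      exact mul_nonneg hε.1.le (div_nonneg (residueClass_nonneg a n) (by positivity))
    have h3 := mul_le_mul_of_nonneg_left h1 hε.1.le
    have h4 : ε * ((q.totient : ℝ)⁻¹ / ε - C) = (q.totient : ℝ)⁻¹ - ε * C := by
      field_simp [hε.1.ne']
    linarith
  have hlim2 : Tendsto (fun ε : ℝ => ∑' n, w ε n + ε * (∑' n, v n) + ε * C) (𝓝[>] 0) (𝓝 0) := by
    have h1 : Tendsto (fun ε : ℝ => ε) (𝓝[>] 0) (𝓝 0) := nhdsWithin_le_nhds
    simpa using (hlim.add (h1.mul_const (∑' n, v n))).add (h1.mul_const C)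
  have h0 : (q.totient : ℝ)⁻¹ ≤ 0 := ge_of_tendsto hlim2 <|
    (eventually_mem_set.2 (Ioc_mem_nhdsGT one_pos)).mono hsum
  have : 0 < (q.totient : ℝ)⁻¹ := inv_pos.mpr (mod_cast q.totient.pos_of_neZero)
  linarith

/-! ### Sieving by primes congruent to 5 modulo 6 -/

/-- Counting residues satisfying two periodic conditions with coprime periods. -/
theorem card_filter_range_mul_of_periodic {M K : ℕ} (hMK : M.Coprime K) (hM : M ≠ 0) (hK : K ≠ 0)
    {A B : ℕ → Prop} [DecidablePred A] [DecidablePred B] (hA : Function.Periodic A M)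
    (hB : Function.Periodic B K) :
    ((Finset.range (M * K)).filter fun n => A n ∧ B n).card =
      ((Finset.range M).filter A).card * ((Finset.range K).filter B).card := by
  rw [← Finset.card_product]
  refine Finset.card_bij (fun n _ => (n % M, n % K)) ?_ ?_ ?_
  · intro n hn
    simp only [Finset.mem_filter, Finset.mem_product, Finset.mem_range] at hn ⊢
    exact ⟨⟨Nat.mod_lt _ (Nat.pos_of_ne_zero hM), by rw [hA.map_mod_nat]; exact hn.2.1⟩,
      Nat.mod_lt _ (Nat.pos_of_ne_zero hK), by rw [hB.map_mod_nat]; exact hn.2.2⟩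
  · intro n hn n' hn' h
    simp only [Finset.mem_filter, Finset.mem_range, Prod.mk.injEq] at hn hn' h
    exact Nat.ModEq.eq_of_lt_of_lt ((Nat.modEq_and_modEq_iff_modEq_mul hMK).1 h) hn.1 hn'.1
  · rintro ⟨a, b⟩ hab
    simp only [Finset.mem_filter, Finset.mem_product, Finset.mem_range] at hab
    obtain ⟨⟨ha, hAa⟩, hb, hBb⟩ := hab
    have h1 : (Nat.chineseRemainder hMK a b : ℕ) % M = a :=
      Eq.trans (Nat.chineseRemainder hMK a b).2.1 (Nat.mod_eq_of_lt ha)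
    have h2 : (Nat.chineseRemainder hMK a b : ℕ) % K = b :=
      Eq.trans (Nat.chineseRemainder hMK a b).2.2 (Nat.mod_eq_of_lt hb)
    refine ⟨Nat.chineseRemainder hMK a b, ?_, Prod.ext h1 h2⟩
    simp only [Finset.mem_filter, Finset.mem_range]
    refine ⟨Nat.chineseRemainder_lt_mul hMK a b hM hK, ?_, ?_⟩
    · rwa [← hA.map_mod_nat, h1]
    · rwa [← hB.map_mod_nat, h2]

theorem card_filter_range_le_of_periodic {M : ℕ} (hM : 0 < M) {A : ℕ → Prop} [DecidablePred A]
    (hA : Function.Periodic A M) (n : ℕ) :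
    ((Finset.range (n + 1)).filter A).card ≤ (n / M + 1) * ((Finset.range M).filter A).card := by
  have hmul : ∀ q, ((Finset.range (q * M)).filter A).card = q * ((Finset.range M).filter A).card := by
    intro q
    simp only [← Nat.count_eq_card_filter_range]
    induction q with
    | zero => simp
    | succ q ih =>
      rw [Nat.succ_mul, Nat.count_add, ih, Nat.succ_mul]
      congr 2
      ext k
      rw [add_comm, ← Nat.cast_id q, hA.nat_mul q k]
  rw [← hmul]
  refine Finset.card_le_card (Finset.filter_subset_filter _ (Finset.range_mono ?_))
  rw [add_mul, one_mul, mul_comm]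
  exact Nat.lt_mul_div_succ n hM

/-- `p` exactly divides `6 * n + 1`. -/
def ExactlyDivides (p n : ℕ) : Prop := p ∣ 6 * n + 1 ∧ ¬ p ^ 2 ∣ 6 * n + 1

theorem periodic_exactlyDivides (p : ℕ) : Function.Periodic (ExactlyDivides p) (p ^ 2) := by
  intro n
  have h2 : p ^ 2 ∣ 6 * (n + p ^ 2) + 1 ↔ p ^ 2 ∣ 6 * n + 1 := by
    rw [show 6 * (n + p ^ 2) + 1 = 6 * n + 1 + p ^ 2 * 6 by ring, Nat.dvd_add_left ⟨6, rfl⟩]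
  have h1 : p ∣ 6 * (n + p ^ 2) + 1 ↔ p ∣ 6 * n + 1 := by
    rw [show 6 * (n + p ^ 2) + 1 = 6 * n + 1 + p * (p * 6) by ring, Nat.dvd_add_left ⟨_, rfl⟩]
  rw [ExactlyDivides, ExactlyDivides, h1, h2]

open Classical in
-- Modulo `p ^ 2` there are at least `p` residues with `p ∣ 6 * n + 1`, and at most one of them has
-- `p ^ 2 ∣ 6 * n + 1`.
theorem le_card_filter_exactlyDivides {p : ℕ} (hp : p % 6 = 5) :
    p ≤ ((Finset.range (p ^ 2)).filter (ExactlyDivides p)).card + 1 := by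
  have h1 : p ≤ ((Finset.range (p ^ 2)).filter fun n => p ∣ 6 * n + 1).card := by
    conv_lhs => rw [← Finset.card_range p]
    -- As p = 6⌊p/6⌋ + 5, the choice n = 5⌊p/6⌋ + 4 gives 6n + 1 = 5p.
    refine Finset.card_le_card_of_injOn (fun t => 5 * (p / 6) + 4 + p * t) ?_ ?_
    · intro t ht
      have ht' : t + 1 ≤ p := by simpa using ht
      have h := Nat.mul_le_mul_left p ht'
      rw [mul_add_one] at h
      simp only [Finset.coe_filter, Finset.mem_range, Set.mem_ofPred_eq]
      refine ⟨by rw [pow_two]; omega, 5 + 6 * t, ?_⟩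
      have : p * (5 + 6 * t) = 5 * p + 6 * (p * t) := by ring
      omega
    · intro t _ t' _ h
      have : 0 < p := by omega
      simpa [this.ne'] using h
  have h2 : ((Finset.range (p ^ 2)).filter fun n => p ^ 2 ∣ 6 * n + 1).card ≤ 1 := by
    rw [Finset.card_le_one]
    intro n hn n' hn'
    simp only [Finset.mem_filter, Finset.mem_range] at hn hn'
    have hcop : (p ^ 2).Coprime 6 := by
      rw [Nat.Coprime, Nat.gcd_comm, Nat.gcd_rec, Nat.pow_mod, hp]
      rfl
    have h : 6 * n + 1 ≡ 6 * n' + 1 [MOD p ^ 2] :=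
      ((Nat.modEq_zero_iff_dvd).2 hn.2).trans ((Nat.modEq_zero_iff_dvd).2 hn'.2).symm
    exact Nat.ModEq.eq_of_lt_of_lt
      (Nat.ModEq.cancel_left_of_coprime hcop (Nat.ModEq.add_right_cancel' 1 h)) hn.1 hn'.1
  have h3 : ((Finset.range (p ^ 2)).filter fun n => p ∣ 6 * n + 1) ⊆
      ((Finset.range (p ^ 2)).filter (ExactlyDivides p)) ∪
        ((Finset.range (p ^ 2)).filter fun n => p ^ 2 ∣ 6 * n + 1) := by
    intro n hn
    simp only [Finset.mem_filter, Finset.mem_union, ExactlyDivides] at hn ⊢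
    tauto
  have h4 := (Finset.card_le_card h3).trans (Finset.card_union_le _ _)
  omega

open Classical in
-- The count is at most p² - p + 1 ≤ p²(1 - 1/(2p)); the factor 1/2 absorbs the extra 1.
theorem card_filter_not_exactlyDivides_le {p : ℕ} (hp : p % 6 = 5) :
    (((Finset.range (p ^ 2)).filter fun n => ¬ ExactlyDivides p n).card : ℝ) ≤
      (p ^ 2 : ℕ) * Real.exp (-(1 / (p : ℝ) / 2)) := by
  have h1 := le_card_filter_exactlyDivides hp
  have h2 := Finset.card_filter_add_card_filter_not (s := Finset.range (p ^ 2)) (ExactlyDivides p)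
  rw [Finset.card_range] at h2
  have h3 : (((Finset.range (p ^ 2)).filter fun n => ¬ ExactlyDivides p n).card : ℝ) + p
      ≤ (p ^ 2 : ℕ) + 1 := by
    exact_mod_cast (by omega)
  have hp5 : (5 : ℝ) ≤ p := by exact_mod_cast (by omega : 5 ≤ p)
  have h4 := Real.add_one_le_exp (-(1 / (p : ℝ) / 2))
  have h5 := mul_le_mul_of_nonneg_left h4 (Nat.cast_nonneg (α := ℝ) (p ^ 2))
  have h6 : ((p ^ 2 : ℕ) : ℝ) * (-(1 / (p : ℝ) / 2) + 1) = (p ^ 2 : ℕ) - p / 2 := by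
    push_cast
    field_simp
    ring
  linarith

/-- No prime in `T` exactly divides `6 * n + 1`. -/
def AvoidsAll (T : Finset ℕ) (n : ℕ) : Prop := ∀ p ∈ T, ¬ ExactlyDivides p n

theorem periodic_avoidsAll (T : Finset ℕ) :
    Function.Periodic (AvoidsAll T) (∏ p ∈ T, p ^ 2) := by
  intro n
  refine propext (forall₂_congr fun p hp => not_congr ?_)
  obtain ⟨k, hk⟩ := Finset.dvd_prod_of_mem (fun p => p ^ 2) hp
  rw [hk, mul_comm]
  exact iff_of_eq ((periodic_exactlyDivides p).nat_mul k n)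

open Classical in
-- The conditions for distinct primes have coprime periods, so the single-prime bounds multiply.
theorem card_filter_avoidsAll_le (T : Finset ℕ) (hT : ∀ p ∈ T, p.Prime ∧ p % 6 = 5) :
    (((Finset.range (∏ p ∈ T, p ^ 2)).filter (AvoidsAll T)).card : ℝ) ≤
      (∏ p ∈ T, p ^ 2 : ℕ) * Real.exp (-((∑ p ∈ T, 1 / (p : ℝ)) / 2)) := by
  induction T using Finset.induction_on with
  | empty => simpa using Finset.card_filter_le {0} (AvoidsAll ∅)
  | insert p T hpT ih =>
    have hp := hT p (Finset.mem_insert_self p T)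
    have hT' : ∀ q ∈ T, q.Prime ∧ q % 6 = 5 := fun q hq => hT q (Finset.mem_insert_of_mem hq)
    have hcop : (p ^ 2).Coprime (∏ q ∈ T, q ^ 2) := Nat.Coprime.prod_right fun q hq =>
      Nat.Coprime.pow 2 2 ((Nat.coprime_primes hp.1 (hT' q hq).1).2 fun h => hpT (h ▸ hq))
    have hK : ∏ q ∈ T, q ^ 2 ≠ 0 :=
      Finset.prod_ne_zero_iff.2 fun q hq => pow_ne_zero 2 (hT' q hq).1.ne_zero
    have hA : Function.Periodic (fun n => ¬ ExactlyDivides p n) (p ^ 2) := fun n =>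
      congrArg Not (periodic_exactlyDivides p n)
    have hcard := card_filter_range_mul_of_periodic hcop (pow_ne_zero 2 hp.1.ne_zero) hK hA
      (periodic_avoidsAll T)
    have hins : AvoidsAll (insert p T) = fun n => ¬ ExactlyDivides p n ∧ AvoidsAll T n := by
      funext n
      simp [AvoidsAll]
    rw [Finset.prod_insert hpT, Finset.sum_insert hpT]
    simp only [hins]
    rw [hcard, add_div, neg_add, Real.exp_add, Nat.cast_mul, Nat.cast_mul]
    calc _ ≤ ((p ^ 2 : ℕ) * Real.exp (-(1 / (p : ℝ) / 2))) * ((∏ p ∈ T, p ^ 2 : ℕ) *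
          Real.exp (-((∑ p ∈ T, 1 / (p : ℝ)) / 2))) :=
          mul_le_mul (card_filter_not_exactlyDivides_le hp.2) (ih hT') (Nat.cast_nonneg _)
            (by positivity)
      _ = _ := by ring

/-! ### Density of the odd values -/

theorem exists_finset_prime_lt_sum_one_div (C : ℝ) :
    ∃ T : Finset ℕ, (∀ p ∈ T, p.Prime ∧ p % 6 = 5) ∧ C < ∑ p ∈ T, 1 / (p : ℝ) := by
  classical
  have h := not_summable_one_div_prime_residueClass (q := 6) (a := 5) (by decide)
  rw [not_summable_iff_tendsto_nat_atTop_of_nonneg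
    fun n => Set.indicator_nonneg (fun _ _ => by positivity) n] at h
  obtain ⟨N, hN⟩ := (h.eventually_gt_atTop C).exists
  refine ⟨(Finset.range N).filter fun p => p.Prime ∧ (p : ZMod 6) = 5, fun p hp => ?_, ?_⟩
  · rw [Finset.mem_filter] at hp
    refine ⟨hp.2.1, ?_⟩
    have : ((p : ℕ) : ZMod 6) = ((5 : ℕ) : ZMod 6) := hp.2.2
    exact (ZMod.natCast_eq_natCast_iff' p 5 6).1 this
  · rw [Finset.sum_filter]
    refine hN.trans_eq (Finset.sum_congr rfl fun p _ => ?_)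
    simp [Set.indicator_apply]

theorem avoidsAll_of_odd_cp {T : Finset ℕ} (hT : ∀ p ∈ T, p.Prime ∧ p % 6 = 5) {n : ℕ}
    (h : ¬ Even (cp 5 1 6 n)) : AvoidsAll T n := by
  intro p hp hd
  obtain ⟨hpp, hp5⟩ := hT p hp
  refine h (even_cp_of_odd_factorization hpp (show p % 3 = 2 % 3 by omega) ?_)
  have h1 := (hpp.dvd_iff_one_le_factorization (by omega)).1 hd.1
  have h2 := mt (hpp.pow_dvd_iff_le_factorization (by omega)).2 hd.2
  rw [show (6 * n + 1).factorization p = 1 by omega]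
  exact odd_one

theorem tendsto_card_odd_cp_div :
    Tendsto (fun n : ℕ =>
      (((Finset.Icc 1 n).filter (fun k => ¬ Even (cp 5 1 6 k))).card : ℝ) / (n : ℝ))
      atTop (𝓝 0) := by
  classical
  rw [Metric.tendsto_atTop]
  intro ε hε
  -- With this bound exp(-(∑ 1/p)/2) is below ε/2; the other ε/2 is for the incomplete last period.
  obtain ⟨T, hT, hC⟩ := exists_finset_prime_lt_sum_one_div (-2 * Real.log (ε / 2))
  set M := ∏ p ∈ T, p ^ 2 with hM
  set c := ((Finset.range M).filter (AvoidsAll T)).card with hc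
  have hM0 : 0 < M := Finset.prod_pos fun p hp => pow_pos (hT p hp).1.pos 2
  have hM0' : (0 : ℝ) < M := by exact_mod_cast hM0
  have hcM : (c : ℝ) ≤ M * (ε / 2) := by
    refine (card_filter_avoidsAll_le T hT).trans (mul_le_mul_of_nonneg_left ?_ hM0'.le)
    rw [← Real.exp_log (half_pos hε)]
    exact Real.exp_le_exp.2 (by linarith)
  have hev : ∀ᶠ n : ℕ in atTop, (c : ℝ) / n < ε / 2 :=
    (tendsto_const_div_atTop_nhds_zero_nat (c : ℝ)).eventually_lt_const (half_pos hε)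
  obtain ⟨N, hN⟩ := eventually_atTop.1 (hev.and (eventually_gt_atTop 0))
  refine ⟨N, fun n hn => ?_⟩
  obtain ⟨hn1, hn0⟩ := hN n hn
  have hn0' : (0 : ℝ) < n := by exact_mod_cast hn0
  have hle : ((Finset.Icc 1 n).filter (fun k => ¬ Even (cp 5 1 6 k))).card ≤ (n / M + 1) * c := by
    refine (Finset.card_le_card fun k hk => ?_).trans
      (card_filter_range_le_of_periodic hM0 (periodic_avoidsAll T) n)
    simp only [Finset.mem_filter, Finset.mem_Icc, Finset.mem_range] at hk ⊢
    exact ⟨by omega, avoidsAll_of_odd_cp hT hk.2⟩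
  have hle' : (((Finset.Icc 1 n).filter (fun k => ¬ Even (cp 5 1 6 k))).card : ℝ) ≤
      (n / M + 1) * c := by
    refine (Nat.cast_le.2 hle).trans ?_
    rw [Nat.cast_mul, Nat.cast_add, Nat.cast_one]
    exact mul_le_mul_of_nonneg_right (by linarith [@Nat.cast_div_le ℝ _ _ _ n M])
      (Nat.cast_nonneg c)
  rw [Real.dist_0_eq_abs, abs_of_nonneg (by positivity)]
  calc _ ≤ ((n : ℝ) / M + 1) * c / n := by gcongr
    _ = c / M + c / n := by field_simp
    _ < ε / 2 + ε / 2 := by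
      refine add_lt_add_of_le_of_lt ?_ hn1
      rwa [div_le_iff₀ hM0', mul_comm]
    _ = ε := add_halves ε

theorem mainTheorem2 :
    Tendsto (fun n : ℕ =>
        (((Finset.Icc 1 n).filter (fun k => Even (cp 5 1 6 k))).card : ℝ) / (n : ℝ))
      atTop (𝓝 1) ∧
    ∀ n : ℕ, (∃ p : ℕ, p.Prime ∧ p ≡ 2 [MOD 3] ∧ Odd ((6 * n + 1).factorization p)) →
      Even (cp 5 1 6 n) := by
  refine ⟨?_, fun n ⟨p, hp, h3, h⟩ => even_cp_of_odd_factorization hp h3 h⟩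
  have h := tendsto_card_odd_cp_div.const_sub 1
  rw [sub_zero] at h
  -- At n = 0 both quotients are 0 by convention, so the two proportions add up to 1 only for n > 0.
  refine h.congr' ((eventually_gt_atTop 0).mono fun n hn => ?_)
  have hn' : (n : ℝ) ≠ 0 := by exact_mod_cast hn.ne'
  have hsum := Finset.card_filter_add_card_filter_not (s := Finset.Icc 1 n)
    fun k => Even (cp 5 1 6 k)
  rw [Nat.card_Icc, Nat.add_sub_cancel] at hsum
  rw [sub_eq_iff_eq_add, ← add_div, eq_div_iff hn', one_mul]
  exact_mod_cast hsum.symm
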